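/- Let $E$ be a real normed space. A $1$-type over $E$ is a semi-norm $\|\cdot\|^\xi$ on $E(x)=E\oplus\mathbb{R}x$ that extends the norm of $E$; let $S_1(E)$ be the set of $1$-types. The topology on $S_1(E)$ is the least one for which $\xi\mapsto\|z\|^\xi$ is continuous for each $z\in E(x)$. An element $c$ of a Banach space $F\supseteq E$ (isometrically) realises $\xi$ if $\|a+\alpha c\|=\|a+\alpha x\|^\xi$ for all $a\in E$, $\alpha\in\mathbb{R}$, and the distance $d(\xi,\zeta)$ is the infimum of $\|c-d\|$ over all Banach spaces $F\supseteq E$ and all realisations $c,d\in F$ of $\xi,\zeta$ respectively. A type $\xi$ is isolated if for every $\varepsilon>0$ the ball $\{\zeta : d(\xi,\zeta)<\varepsilon\}$ is a neighbourhood of $\xi$ in the topology. For a convex set $X\subseteq E$, let $K_C(X)$ be the set of convex functions $f\colon X\to\mathbb{R}$ such that $f(x)\le f(y)+\|x-y\|$ and $\|x-y\|\le f(x)+f(y)$ for all $x,y\in X$. If $X\ne\emptyset$, the canonical extension of $f\in K_C(X)$ to $E$ is $\tilde f(y)=\inf_{x\in X}\bigl(f(x)+\|x-y\|\bigr)$.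 The map $\xi\mapsto f_\xi$, $f_\xi(a)=\|x-a\|^\xi$, is a bijection of $S_1(E)$ onto $K_C(E)$, by which the two sets are identified. For $f\in K_C(E)$ and $\lambda\in E^*$ put $f^*(\lambda)=\sup_{v\in E}\bigl(\lambda v-f(v)\bigr)\in\mathbb{R}\cup\{\infty\}$. Call $f\in K_C(E)$ - local if there are non-empty compact convex sets $X_k\subseteq E$ and $f_k\in K_C(X_k)$, $k\in\mathbb{N}$, such that $\tilde f_k\to f$ uniformly on $E$; - $\partial$-maximal if for every $g\in K_C(E)$ with $g\le f$ one has $g^*(\lambda)\le f^*(\lambda)$ for all $\lambda\in E^*$ with $\|\lambda\|=1$. Theorem. Let $f\in K_C(E)$. Then (the $1$-type identified with) $f$ is isolated if and only if $f$ is both local and $\partial$-maximal. -/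

import Mathlib

open Filter Topology

universe u

/-- `f` is a convex Katětov function on the (convex) set `X`; only the values of `f` on `X`
matter. -/
structure IsConvexKatetovOn {E : Type u} [NormedAddCommGroup E] [NormedSpace ℝ E]
    (X : Set E) (f : E → ℝ) : Prop where
  convexOn : ConvexOn ℝ X f
  le_add_dist : ∀ x ∈ X, ∀ y ∈ X, f x ≤ f y + dist x y
  dist_le_add : ∀ x ∈ X, ∀ y ∈ X, dist x y ≤ f x + f y

/-- The set `K_C(E)` of convex Katětov functions on the normed space `E`. -/
def ConvexKatetov (E : Type u) [NormedAddCommGroup E] [NormedSpace ℝ E] : Type u :=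
  {f : E → ℝ // IsConvexKatetovOn Set.univ f}

/-- The space `S₁(E)` of 1-types over `E`: semi-norms on `E(x) = E ⊕ ℝ x` which extend the norm
of `E`. The pair `(a, α)` stands for `a + α x`. -/
def OneType (E : Type u) [NormedAddCommGroup E] [NormedSpace ℝ E] : Type u :=
  {p : Seminorm ℝ (E × ℝ) // ∀ a : E, p (a, 0) = ‖a‖}

namespace OneType

variable {E : Type u} [NormedAddCommGroup E] [NormedSpace ℝ E]

/-- The least topology for which `ξ ↦ ‖z‖^ξ` is continuous for each `z ∈ E(x)`. -/
instance instTopologicalSpace : TopologicalSpace (OneType E) :=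
  TopologicalSpace.induced (fun ξ (z : E × ℝ) => ξ.1 z) inferInstance

/-- In the extension `i : E → F`, the element `c` of `F` realises the type `ξ`. -/
def Realises {F : Type u} [NormedAddCommGroup F] [NormedSpace ℝ F]
    (i : E →ₗᵢ[ℝ] F) (c : F) (ξ : OneType E) : Prop :=
  ∀ (a : E) (α : ℝ), ‖i a + α • c‖ = ξ.1 (a, α)

/-- The distance between 1-types: the infimum of `‖c - d‖` over all Banach space extensions `F`
of `E` and all realisations `c` of `ξ` and `d` of `ζ` in `F`. -/
noncomputable def typeDist (ξ ζ : OneType E) : ENNReal :=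
  sInf {r : ENNReal | ∃ (F : Type u) (_ : NormedAddCommGroup F) (_ : NormedSpace ℝ F)
    (_ : CompleteSpace F) (i : E →ₗᵢ[ℝ] F) (c d : F),
    Realises i c ξ ∧ Realises i d ζ ∧ r = ENNReal.ofReal ‖c - d‖}

/-- A type is isolated if each of its neighbourhoods for the distance is also a neighbourhood
for the topology. -/
def IsIsolated (ξ : OneType E) : Prop :=
  ∀ ε : ENNReal, 0 < ε → {ζ : OneType E | typeDist ξ ζ < ε} ∈ 𝓝 ξ

/-- The function `f_ξ(a) = ‖x - a‖^ξ`. -/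
def toFun (ξ : OneType E) (a : E) : ℝ := ξ.1 (-a, 1)

theorem isConvexKatetovOn_toFun (ξ : OneType E) : IsConvexKatetovOn Set.univ ξ.toFun := by
  refine ⟨⟨convex_univ, ?_⟩, ?_, ?_⟩
  · intro x _ y _ s t hs ht hst
    have h := map_add_le_add ξ.1 (s • ((-x, 1) : E × ℝ)) (t • ((-y, 1) : E × ℝ))
    rw [map_smul_eq_mul, map_smul_eq_mul, Real.norm_of_nonneg hs, Real.norm_of_nonneg ht] at h
    have e : s • ((-x, 1) : E × ℝ) + t • ((-y, 1) : E × ℝ) = (-(s • x + t • y), 1) := by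
      ext
      · simp only [Prod.fst_add, Prod.smul_fst]; module
      · simpa using hst
    rw [e] at h
    exact h
  · intro x _ y _
    have h := map_add_le_add ξ.1 ((-y, 1) : E × ℝ) ((y - x, 0) : E × ℝ)
    have e : ((-y, 1) : E × ℝ) + (y - x, 0) = (-x, 1) := by
      ext
      · simp only [Prod.fst_add]; abel
      · simp
    rw [e, ξ.2, ← dist_eq_norm, dist_comm] at h
    exact h
  · intro x _ y _
    have h := map_sub_le_add ξ.1 ((-y, 1) : E × ℝ) ((-x, 1) : E × ℝ)
    have e : ((-y, 1) : E × ℝ) - (-x, 1) = (x - y, 0) := by ext <;> simp [sub_eq_add_neg, add_comm]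
    rw [e, ξ.2, ← dist_eq_norm, add_comm] at h
    exact h

end OneType

namespace ConvexKatetov

variable {E : Type u} [NormedAddCommGroup E] [NormedSpace ℝ E]

/-- The semi-norm `‖a + α x‖ = |α| f(-a/α)` for `α ≠ 0`, and `‖a‖` for `α = 0`. -/
noncomputable def seminormFun (f : E → ℝ) (z : E × ℝ) : ℝ :=
  if z.2 = 0 then ‖z.1‖ else |z.2| * f (-(z.2⁻¹ • z.1))

theorem seminormFun_smul (f : E → ℝ) (c : ℝ) (z : E × ℝ) :
    seminormFun f (c • z) = ‖c‖ * seminormFun f z := by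
  obtain ⟨a, α⟩ := z
  rcases eq_or_ne c 0 with rfl | hc
  · simp [seminormFun]
  rcases eq_or_ne α 0 with rfl | hα
  · simp [seminormFun, norm_smul]
  have e : (c * α)⁻¹ • (c • a) = α⁻¹ • a := by
    rw [smul_smul]; congr 1; field_simp
  simp only [seminormFun, Prod.smul_mk, smul_eq_mul, mul_eq_zero, hc, hα, or_self, if_false, e,
    abs_mul, Real.norm_eq_abs]
  ring

theorem seminormFun_neg (f : E → ℝ) (z : E × ℝ) : seminormFun f (-z) = seminormFun f z := by
  have := seminormFun_smul f (-1) z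
  simpa using this

theorem seminormFun_of_ne (f : E → ℝ) {α : ℝ} (h : α ≠ 0) (x : E) :
    seminormFun f (-(α • x), α) = |α| * f x := by
  simp [seminormFun, h, smul_smul]

theorem seminormFun_zero (f : E → ℝ) (a : E) : seminormFun f (a, 0) = ‖a‖ := by
  simp [seminormFun]

theorem exists_rep {α : ℝ} (h : α ≠ 0) (a : E) : ∃ x : E, a = -(α • x) :=
  ⟨-(α⁻¹ • a), by simp [smul_smul, h]⟩

theorem seminormFun_add_of_pos {f : E → ℝ} (hf : IsConvexKatetovOn Set.univ f)
    (z w : E × ℝ) (hz : 0 < z.2) (hzw : 0 < z.2 + w.2) :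
    seminormFun f (z + w) ≤ seminormFun f z + seminormFun f w := by
  obtain ⟨a, s⟩ := z
  obtain ⟨b, t⟩ := w
  simp only at hz hzw
  obtain ⟨x, rfl⟩ := exists_rep hz.ne' a
  rcases lt_trichotomy t 0 with ht | rfl | ht
  · obtain ⟨y, rfl⟩ := exists_rep ht.ne b
    obtain ⟨v, hv⟩ := exists_rep hzw.ne' (-(s • x) + -(t • y))
    rw [Prod.mk_add_mk, hv, seminormFun_of_ne f hz.ne', seminormFun_of_ne f ht.ne,
      seminormFun_of_ne f hzw.ne', abs_of_pos hz, abs_of_neg ht, abs_of_pos hzw]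
    have h1 := hf.le_add_dist v trivial x trivial
    have h2 := hf.dist_le_add x trivial y trivial
    have h3 : (s + t) * dist v x = -t * dist x y := by
      rw [dist_eq_norm, dist_eq_norm, ← abs_of_pos hzw, ← abs_of_neg ht, ← Real.norm_eq_abs,
        ← Real.norm_eq_abs, ← norm_smul, ← norm_smul, ← norm_neg]
      congr 1
      have : (s + t) • v = s • x + t • y := by
        rw [← neg_inj, ← hv]; abel
      rw [smul_sub, this]
      module
    nlinarith [mul_le_mul_of_nonneg_left h1 hzw.le,
      mul_le_mul_of_nonneg_left h2 (neg_nonneg.2 ht.le)]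
  · obtain ⟨v, hv⟩ := exists_rep hz.ne' (-(s • x) + b)
    rw [Prod.mk_add_mk, hv, add_zero, seminormFun_of_ne f hz.ne', seminormFun_of_ne f hz.ne',
      seminormFun_zero, abs_of_pos hz]
    have h1 := hf.le_add_dist v trivial x trivial
    have h3 : s * dist v x = ‖b‖ := by
      rw [dist_eq_norm, ← abs_of_pos hz, ← Real.norm_eq_abs, ← norm_smul, ← norm_neg]
      congr 1
      have : s • v = s • x - b := by
        rw [← neg_inj, ← hv]; abel
      rw [smul_sub, this]
      abel
    nlinarith [mul_le_mul_of_nonneg_left h1 hz.le]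
  · obtain ⟨y, rfl⟩ := exists_rep ht.ne' b
    have h := hf.convexOn.2 (Set.mem_univ x) (Set.mem_univ y) (div_nonneg hz.le hzw.le)
      (div_nonneg ht.le hzw.le) (by field_simp)
    have hv : -(s • x) + -(t • y) = -((s + t) • ((s / (s + t)) • x + (t / (s + t)) • y)) := by
      rw [smul_add, smul_smul, smul_smul, mul_div_cancel₀ _ hzw.ne', mul_div_cancel₀ _ hzw.ne']
      abel
    rw [Prod.mk_add_mk, hv, seminormFun_of_ne f hz.ne', seminormFun_of_ne f ht.ne',
      seminormFun_of_ne f hzw.ne', abs_of_pos hz, abs_of_pos ht, abs_of_pos hzw]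
    calc (s + t) * f ((s / (s + t)) • x + (t / (s + t)) • y)
        ≤ (s + t) * ((s / (s + t)) • f x + (t / (s + t)) • f y) :=
          mul_le_mul_of_nonneg_left h hzw.le
      _ = s * f x + t * f y := by
          simp only [smul_eq_mul]; field_simp

theorem seminormFun_add_of_pos' {f : E → ℝ} (hf : IsConvexKatetovOn Set.univ f)
    (z w : E × ℝ) (hzw : 0 < z.2 + w.2) :
    seminormFun f (z + w) ≤ seminormFun f z + seminormFun f w := by
  rcases lt_or_ge 0 z.2 with h | h
  · exact seminormFun_add_of_pos hf z w h hzw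
  · rw [add_comm z, add_comm (seminormFun f z)]
    exact seminormFun_add_of_pos hf w z (by linarith) (by linarith)

theorem seminormFun_add {f : E → ℝ} (hf : IsConvexKatetovOn Set.univ f) (z w : E × ℝ) :
    seminormFun f (z + w) ≤ seminormFun f z + seminormFun f w := by
  rcases lt_trichotomy (z.2 + w.2) 0 with h | h | h
  · rw [← seminormFun_neg f z, ← seminormFun_neg f w, ← seminormFun_neg f (z + w), neg_add]
    exact seminormFun_add_of_pos' hf (-z) (-w) (by simp only [Prod.snd_neg]; linarith)
  · obtain ⟨a, s⟩ := z
    obtain ⟨b, t⟩ := w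
    simp only at h
    obtain rfl : t = -s := by linarith
    rw [Prod.mk_add_mk, h, seminormFun_zero]
    rcases eq_or_ne s 0 with rfl | hs
    · rw [neg_zero, seminormFun_zero, seminormFun_zero]; exact norm_add_le a b
    · obtain ⟨x, rfl⟩ := exists_rep hs a
      obtain ⟨y, rfl⟩ := exists_rep (neg_ne_zero.2 hs) b
      rw [seminormFun_of_ne f hs, seminormFun_of_ne f (neg_ne_zero.2 hs), abs_neg, ← mul_add]
      have e : -(s • x) + -(-s • y) = s • (y - x) := by module
      rw [e, norm_smul, Real.norm_eq_abs, ← dist_eq_norm, dist_comm]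
      exact mul_le_mul_of_nonneg_left (hf.dist_le_add x trivial y trivial) (abs_nonneg s)
  · exact seminormFun_add_of_pos' hf z w h

/-- The 1-type which corresponds to a convex Katětov function. -/
noncomputable def toOneType (f : ConvexKatetov E) : OneType E :=
  ⟨Seminorm.of (seminormFun f.1) (seminormFun_add f.2) (seminormFun_smul f.1),
    fun a => seminormFun_zero f.1 a⟩

end ConvexKatetov

/-- The identification of the 1-types over `E` with the convex Katětov functions on `E`. -/
noncomputable def oneTypeEquiv (E : Type u) [NormedAddCommGroup E] [NormedSpace ℝ E] :
    OneType E ≃ ConvexKatetov E where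
  toFun ξ := ⟨ξ.toFun, ξ.isConvexKatetovOn_toFun⟩
  invFun f := f.toOneType
  left_inv ξ := by
    apply Subtype.ext
    ext ⟨a, α⟩
    change ConvexKatetov.seminormFun ξ.toFun (a, α) = ξ.1 (a, α)
    rcases eq_or_ne α 0 with rfl | h
    · rw [ConvexKatetov.seminormFun_zero, ξ.2]
    · obtain ⟨x, rfl⟩ := ConvexKatetov.exists_rep h a
      rw [ConvexKatetov.seminormFun_of_ne _ h]
      have e : ((-(α • x), α) : E × ℝ) = α • (-x, 1) := by ext <;> simp
      rw [e, map_smul_eq_mul, Real.norm_eq_abs]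
      rfl
  right_inv f := by
    apply Subtype.ext
    funext a
    change ConvexKatetov.seminormFun f.1 (-a, 1) = f.1 a
    have := ConvexKatetov.seminormFun_of_ne f.1 one_ne_zero a
    simpa using this

/-- The canonical extension `y ↦ inf_{x ∈ X} (f x + d(x, y))` of a function `f` on `X`. -/
noncomputable def katetovExt {E : Type u} [NormedAddCommGroup E] [NormedSpace ℝ E]
    (X : Set E) (f : E → ℝ) (y : E) : ℝ :=
  ⨅ x : X, (f x + dist (x : E) y)

/-- The convex conjugate `f*(l) = sup_{v ∈ E} (l v - f v)` on the dual space, with values in the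
extended reals. -/
noncomputable def convexConj {E : Type u} [NormedAddCommGroup E] [NormedSpace ℝ E]
    (f : E → ℝ) (l : StrongDual ℝ E) : EReal :=
  ⨆ v : E, ((l v - f v : ℝ) : EReal)

namespace ConvexKatetov

variable {E : Type u} [NormedAddCommGroup E] [NormedSpace ℝ E]

/-- `f` is local: a uniform limit of canonical extensions of convex Katětov functions on
(non-empty) compact convex subsets of `E`. -/
def IsLocal (f : ConvexKatetov E) : Prop :=
  ∃ (X : ℕ → Set E) (φ : ℕ → E → ℝ),
    (∀ k, IsCompact (X k) ∧ (X k).Nonempty ∧ IsConvexKatetovOn (X k) (φ k)) ∧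
    TendstoUniformly (fun k => katetovExt (X k) (φ k)) f.1 atTop

/-- `f` is `∂`-maximal: each `g ≤ f` in `K_C(E)` satisfies `g* ≤ f*` on the dual unit sphere. -/
def IsBoundaryMaximal (f : ConvexKatetov E) : Prop :=
  ∀ g : ConvexKatetov E, (∀ v, g.1 v ≤ f.1 v) →
    ∀ l : StrongDual ℝ E, ‖l‖ = 1 → convexConj g.1 l ≤ convexConj f.1 l

end ConvexKatetov

/-! Under the identification, the topology is pointwise convergence of the functions `f_ξ` and the
distance is the sup distance: the amalgam `amalgam` realises two types at distance at most any given
uniform bound. So `f` is isolated iff every convex Katětov `g` close enough to `f` on a suitable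
finite set is uniformly close to `f`.

If so, the extension of `f` from the hull of such a finite set is close to `f`, hence `f` is local.
Given `g ≤ f`, `exists_between_of_finite` raises `g` to a function close to `f` on the finite set by
maxima with affine functions of slope less than 1. These are invisible far out in a direction that
nearly norms `l`, so a value of `l - g` exceeding `f*(l)` would contradict isolation.

Conversely, let `ψ` be an extension from a compact `X`, close to `f`. If `g` is near `f` on a net of
`X`, the Lipschitz condition bounds `g` above. Off `X`, `ψ` has subgradients of norm one, and
`∂`-maximality, in the approximate form `sub_le_of_le_add`, turns them into a lower bound for `g`.
-/

/-- A copy of `V`, normed by the seminorm `p`. -/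
def SeminormSpace {V : Type*} [AddCommGroup V] [Module ℝ V] (_p : Seminorm ℝ V) : Type _ := V

namespace SeminormSpace

variable {V : Type*} [AddCommGroup V] [Module ℝ V] (p : Seminorm ℝ V)

instance : AddCommGroup (SeminormSpace p) := inferInstanceAs (AddCommGroup V)

instance : Module ℝ (SeminormSpace p) := inferInstanceAs (Module ℝ V)

instance : SeminormedAddCommGroup (SeminormSpace p) :=
  AddGroupSeminorm.toSeminormedAddCommGroup (E := SeminormSpace p) p.toAddGroupSeminorm

instance : NormedSpace ℝ (SeminormSpace p) where
  norm_smul_le c v := (map_smul_eq_mul p c v).le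

/-- The identity map of `V`, as a linear equivalence onto its normed copy. -/
def equiv : V ≃ₗ[ℝ] SeminormSpace p := LinearEquiv.refl ℝ V

end SeminormSpace

theorem Seminorm.inf_apply_eq_left {V : Type*} [AddCommGroup V] [Module ℝ V]
    {p q : Seminorm ℝ V} {z : V} (h : ∀ u, p z ≤ p u + q (z - u)) : (p ⊓ q) z = p z :=
  le_antisymm (inf_le_left (a := p) (b := q) z) (le_ciInf h)

theorem Seminorm.inf_apply_eq_right {V : Type*} [AddCommGroup V] [Module ℝ V]
    {p q : Seminorm ℝ V} {z : V} (h : ∀ u, q z ≤ q u + p (z - u)) : (p ⊓ q) z = q z := by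
  rw [inf_comm]
  exact inf_apply_eq_left h

/-! ### Topology and distance of types in terms of Katětov functions -/

namespace OneType

variable {E : Type u} [NormedAddCommGroup E] [NormedSpace ℝ E]

theorem apply_eq_seminormFun (ξ : OneType E) (z : E × ℝ) :
    ξ.1 z = ConvexKatetov.seminormFun ξ.toFun z := by
  conv_lhs => rw [← (oneTypeEquiv E).symm_apply_apply ξ]
  rfl

theorem toFun_symm (f : ConvexKatetov E) : ((oneTypeEquiv E).symm f).toFun = f.1 :=
  congrArg Subtype.val ((oneTypeEquiv E).apply_symm_apply f)

/-- The inclusion of `E` into `E(x)`, normed by a 1-type. -/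
def inclusion (ξ : OneType E) : E →ₗᵢ[ℝ] SeminormSpace ξ.1 where
  toLinearMap := (SeminormSpace.equiv ξ.1).toLinearMap ∘ₗ LinearMap.inl ℝ E ℝ
  norm_map' a := ξ.2 a

/-- Each value of the seminorm is either constant or a fixed multiple of one value of `f_ξ`. -/
theorem isInducing_toFun : IsInducing (toFun : OneType E → E → ℝ) := by
  refine IsInducing.of_comp (g := fun f z => ConvexKatetov.seminormFun f z) ?_ ?_ ?_
  · refine continuous_pi fun a => ?_
    exact (continuous_apply (-a, (1 : ℝ))).comp continuous_induced_dom
  · refine continuous_pi fun z => ?_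
    unfold ConvexKatetov.seminormFun
    split_ifs
    · exact continuous_const
    · exact continuous_const.mul (continuous_apply _)
  · refine ⟨?_⟩
    have e : ((fun (f : E → ℝ) z => ConvexKatetov.seminormFun f z) ∘ toFun) =
        fun (ξ : OneType E) (z : E × ℝ) => ξ.1 z := by
      funext ξ z
      exact (apply_eq_seminormFun ξ z).symm
    rw [e]
    rfl

theorem mem_nhds_iff {ξ : OneType E} {S : Set (OneType E)} :
    S ∈ 𝓝 ξ ↔ ∃ A : Set E, A.Finite ∧ ∃ δ > 0,
      ∀ ζ : OneType E, (∀ a ∈ A, |ζ.toFun a - ξ.toFun a| < δ) → ζ ∈ S := by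
  rw [isInducing_toFun.nhds_eq_comap, mem_comap, nhds_pi]
  constructor
  · rintro ⟨T, hT, hTS⟩
    obtain ⟨A, hA, t, ht, htT⟩ := mem_pi.1 hT
    have h : ∀ᶠ δ in 𝓝[>] (0 : ℝ), ∀ a ∈ A, Metric.ball (ξ.toFun a) δ ⊆ t a := by
      refine hA.eventually_all.2 fun a _ => ?_
      obtain ⟨δ, hδ, hsub⟩ := Metric.mem_nhds_iff.1 (ht a)
      filter_upwards [Ioo_mem_nhdsGT hδ] with δ' h'
      exact (Metric.ball_subset_ball h'.2.le).trans hsub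
    obtain ⟨δ, hδ, h0⟩ := (h.and self_mem_nhdsWithin).exists
    exact ⟨A, hA, δ, h0, fun ζ hζ => hTS (htT fun a ha => hδ a ha (hζ a ha))⟩
  · rintro ⟨A, hA, δ, hδ, h⟩
    refine ⟨A.pi fun a => Metric.ball (ξ.toFun a) δ,
      mem_pi.2 ⟨A, hA, _, fun a => Metric.ball_mem_nhds _ hδ, subset_rfl⟩, fun ζ hζ => h ζ hζ⟩

theorem abs_toFun_sub_le_of_realises {F : Type u} [NormedAddCommGroup F] [NormedSpace ℝ F]
    {i : E →ₗᵢ[ℝ] F} {c d : F} {ξ ζ : OneType E} (hc : Realises i c ξ) (hd : Realises i d ζ)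
    (a : E) : |ξ.toFun a - ζ.toFun a| ≤ ‖c - d‖ := by
  unfold toFun
  rw [← hc, ← hd]
  refine (abs_norm_sub_norm_le _ _).trans_eq ?_
  rw [one_smul, one_smul, add_sub_add_left_eq_sub]

theorem abs_toFun_sub_lt_of_typeDist_lt {ξ ζ : OneType E} {r : ℝ}
    (h : typeDist ξ ζ < ENNReal.ofReal r) (a : E) : |ξ.toFun a - ζ.toFun a| < r := by
  obtain ⟨_, ⟨F, _, _, _, i, c, d, hc, hd, rfl⟩, hlt⟩ := sInf_lt_iff.1 h
  exact (abs_toFun_sub_le_of_realises hc hd a).trans_lt (ENNReal.ofReal_lt_ofReal_iff'.1 hlt).1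

theorem apply_le_add_of_toFun_le {ξ ζ : OneType E} {r : ℝ}
    (h : ∀ a, ξ.toFun a ≤ ζ.toFun a + r) (z : E × ℝ) : ξ.1 z ≤ ζ.1 z + r * |z.2| := by
  obtain ⟨a, α⟩ := z
  rcases eq_or_ne α 0 with rfl | hα
  · simp [ξ.2, ζ.2]
  · obtain ⟨x, rfl⟩ := ConvexKatetov.exists_rep hα a
    rw [apply_eq_seminormFun, apply_eq_seminormFun, ConvexKatetov.seminormFun_of_ne _ hα,
      ConvexKatetov.seminormFun_of_ne _ hα]
    nlinarith [mul_le_mul_of_nonneg_left (h x) (abs_nonneg α)]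

/-- The seminorms `ξ (a + (α + β) x) + r |β|` and `ζ (a + (α + β) x) + r |α|`
on `E ⊕ ℝ x ⊕ ℝ y` have as greatest lower bound a common extension of `ξ` and `ζ`. -/
noncomputable def amalgam (ξ ζ : OneType E) (r : NNReal) : Seminorm ℝ (E × ℝ × ℝ) :=
  (ξ.1.comp (LinearMap.prodMap LinearMap.id (LinearMap.coprod LinearMap.id LinearMap.id)) +
      r • (normSeminorm ℝ ℝ).comp (LinearMap.snd ℝ ℝ ℝ ∘ₗ LinearMap.snd ℝ E (ℝ × ℝ))) ⊓
    (ζ.1.comp (LinearMap.prodMap LinearMap.id (LinearMap.coprod LinearMap.id LinearMap.id)) +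
      r • (normSeminorm ℝ ℝ).comp (LinearMap.fst ℝ ℝ ℝ ∘ₗ LinearMap.snd ℝ E (ℝ × ℝ)))

/-- Replacing `ζ` by `ξ` in a decomposition of `(a, α, 0)` costs at most `r |α - s - t|`, which the
two penalty terms cover; the triangle inequality for `ξ` does the rest. -/
theorem le_amalgam_aux {ξ ζ : OneType E} {r : ℝ} (hr : 0 ≤ r)
    (h : ∀ a, ξ.toFun a ≤ ζ.toFun a + r) (a b : E) (α s t : ℝ) :
    ξ.1 (a, α) ≤ ξ.1 (b, s + t) + r * |t| + (ζ.1 (a - b, α - s + (0 - t)) + r * |α - s|) := by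
  have h1 := map_add_le_add ξ.1 (b, s + t) (a - b, α - s + (0 - t))
  have e : ((b, s + t) : E × ℝ) + (a - b, α - s + (0 - t)) = (a, α) := by
    ext
    · simp
    · simp only [Prod.snd_add]; ring
  rw [e] at h1
  have h2 := apply_le_add_of_toFun_le h (a - b, α - s + (0 - t))
  have h3 : |α - s + (0 - t)| ≤ |α - s| + |t| := by
    simpa using abs_add_le (α - s) (0 - t)
  have h4 := mul_le_mul_of_nonneg_left h3 hr
  simp only at h2
  linarith

theorem amalgam_left {ξ ζ : OneType E} {r : NNReal}
    (h : ∀ a, ξ.toFun a ≤ ζ.toFun a + r) (a : E) (α : ℝ) :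
    amalgam ξ ζ r (a, α, 0) = ξ.1 (a, α) := by
  rw [amalgam, Seminorm.inf_apply_eq_left]
  · simp
  · rintro ⟨b, s, t⟩
    simpa [NNReal.smul_def] using le_amalgam_aux r.2 h a b α s t

theorem amalgam_right {ξ ζ : OneType E} {r : NNReal}
    (h : ∀ a, ζ.toFun a ≤ ξ.toFun a + r) (a : E) (β : ℝ) :
    amalgam ξ ζ r (a, 0, β) = ζ.1 (a, β) := by
  rw [amalgam, Seminorm.inf_apply_eq_right]
  · simp
  · rintro ⟨b, s, t⟩
    simpa [NNReal.smul_def, add_comm] using le_amalgam_aux r.2 h a b β t s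

theorem amalgam_sub_le (ξ ζ : OneType E) (r : NNReal) : amalgam ξ ζ r (0, 1, -1) ≤ r := by
  refine (inf_le_left (α := Seminorm ℝ (E × ℝ × ℝ)) _).trans_eq ?_
  simpa [NNReal.smul_def] using ξ.2 0

theorem typeDist_le {ξ ζ : OneType E} {r : NNReal}
    (h : ∀ a, |ξ.toFun a - ζ.toFun a| ≤ r) : typeDist ξ ζ ≤ r := by
  have h₁ : ∀ a, ξ.toFun a ≤ ζ.toFun a + r := fun a => by linarith [(abs_le.1 (h a)).2]
  have h₂ : ∀ a, ζ.toFun a ≤ ξ.toFun a + r := fun a => by linarith [(abs_le.1 (h a)).1]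
  let N := amalgam ξ ζ r
  let e := SeminormSpace.equiv N
  -- `N` may vanish on non-zero vectors; the completion is separated, hence a Banach space.
  let j : SeminormSpace N →ₗᵢ[ℝ] UniformSpace.Completion (SeminormSpace N) :=
    UniformSpace.Completion.toComplₗᵢ
  let i₀ : E →ₗᵢ[ℝ] SeminormSpace N :=
    { toLinearMap := e.toLinearMap ∘ₗ LinearMap.inl ℝ E (ℝ × ℝ)
      norm_map' := fun a => (amalgam_left h₁ a 0).trans (ξ.2 a) }
  have hj : ∀ v, ‖j (e v)‖ = N v := fun v => j.norm_map (e v)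
  calc typeDist ξ ζ ≤ ENNReal.ofReal ‖j (e (0, 1, 0)) - j (e (0, 0, 1))‖ := by
        refine sInf_le ⟨_, inferInstance, inferInstance, inferInstance, j.comp i₀, _, _,
          fun a α => ?_, fun a α => ?_, rfl⟩
        · change ‖j (e (a, 0)) + α • j (e (0, 1, 0))‖ = _
          rw [← map_smul, ← map_smul, ← map_add, ← map_add, hj, ← amalgam_left h₁]
          simp [N]
        · change ‖j (e (a, 0)) + α • j (e (0, 0, 1))‖ = _
          rw [← map_smul, ← map_smul, ← map_add, ← map_add, hj, ← amalgam_right h₂]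
          simp [N]
    _ ≤ ENNReal.ofReal r := by
        refine ENNReal.ofReal_le_ofReal ?_
        rw [← map_sub, ← map_sub, hj]
        simpa using amalgam_sub_le ξ ζ r
    _ = r := ENNReal.ofReal_coe_nnreal

theorem isIsolated_iff {ξ : OneType E} :
    ξ.IsIsolated ↔ ∀ ε > (0 : ℝ), ∃ A : Set E, A.Finite ∧ ∃ δ > 0,
      ∀ ζ : OneType E, (∀ a ∈ A, |ζ.toFun a - ξ.toFun a| < δ) →
        ∀ a, |ξ.toFun a - ζ.toFun a| ≤ ε := by
  constructor
  · intro h ε hε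
    obtain ⟨A, hA, δ, hδ, H⟩ := mem_nhds_iff.1 (h _ (ENNReal.ofReal_pos.2 hε))
    exact ⟨A, hA, δ, hδ, fun ζ hζ a => (abs_toFun_sub_lt_of_typeDist_lt (H ζ hζ) a).le⟩
  · intro h ε hε
    obtain ⟨r, hr, hrε⟩ := ENNReal.lt_iff_exists_nnreal_btwn.1 hε
    obtain ⟨A, hA, δ, hδ, H⟩ := h r (by exact_mod_cast hr)
    exact mem_nhds_iff.2 ⟨A, hA, δ, hδ, fun ζ hζ => (typeDist_le (H ζ hζ)).trans_lt hrε⟩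

end OneType

/-- A convex Katětov function has at each point a subgradient of norm at most one. -/
theorem IsConvexKatetovOn.exists_subgradient {E : Type u} [NormedAddCommGroup E]
    [NormedSpace ℝ E] {f : E → ℝ} (hf : IsConvexKatetovOn Set.univ f) (y : E) :
    ∃ l : StrongDual ℝ E, ‖l‖ ≤ 1 ∧ ∀ x, f y + l (x - y) ≤ f x := by
  let ξ : OneType E := (oneTypeEquiv E).symm ⟨f, hf⟩
  have hξ : ∀ x, ‖SeminormSpace.equiv ξ.1 (-x, 1)‖ = f x :=
    fun x => congrFun (OneType.toFun_symm ⟨f, hf⟩) x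
  -- Hahn–Banach in `E(x)`: a functional norming `(-y, 1)`, whose seminorm is `f y`. Moving the base
  -- point subtracts a vector of `E`, whence the sign of the subgradient.
  obtain ⟨g, hg, hgy⟩ := exists_dual_vector'' ℝ (SeminormSpace.equiv ξ.1 (-y, 1))
  refine ⟨-(g ∘L ξ.inclusion.toContinuousLinearMap), ?_, fun x => ?_⟩
  · rw [norm_neg]
    refine ContinuousLinearMap.opNorm_le_bound _ zero_le_one fun a => ?_
    calc ‖g (ξ.inclusion a)‖ ≤ ‖g‖ * ‖ξ.inclusion a‖ := g.le_opNorm _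
      _ ≤ 1 * ‖a‖ := by
        rw [ξ.inclusion.norm_map]
        exact mul_le_mul_of_nonneg_right hg (norm_nonneg a)
  · have h1 : g (SeminormSpace.equiv ξ.1 (-x, 1)) ≤ f x := by
      refine (le_abs_self _).trans ((g.le_opNorm _).trans ?_)
      rw [hξ]
      exact mul_le_of_le_one_left (by rw [← hξ]; exact norm_nonneg _) hg
    have e : SeminormSpace.equiv ξ.1 (-x, 1) =
        SeminormSpace.equiv ξ.1 (-y, 1) - ξ.inclusion (x - y) := by
      change SeminormSpace.equiv ξ.1 (-x, 1) =
        SeminormSpace.equiv ξ.1 (-y, 1) - SeminormSpace.equiv ξ.1 (x - y, 0)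
      rw [← map_sub]
      congr 1
      ext
      · simp only [Prod.fst_sub]; abel
      · simp
    rw [e, map_sub, hgy, hξ] at h1
    change f y + -(g (ξ.inclusion (x - y))) ≤ f x
    simpa [sub_eq_add_neg] using h1

/-! ### Canonical extensions and common lower bounds -/

namespace IsConvexKatetovOn

variable {E : Type u} [NormedAddCommGroup E] [NormedSpace ℝ E] {X : Set E} {f g : E → ℝ}

theorem nonneg (hf : IsConvexKatetovOn X f) {x : E} (hx : x ∈ X) : 0 ≤ f x := by
  have := hf.dist_le_add x hx x hx
  rw [dist_self] at this
  linarith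

theorem abs_sub_le_dist (hf : IsConvexKatetovOn X f) {x y : E} (hx : x ∈ X) (hy : y ∈ X) :
    |f x - f y| ≤ dist x y :=
  abs_sub_le_iff.2 ⟨by linarith [hf.le_add_dist x hx y hy],
    by linarith [hf.le_add_dist y hy x hx, dist_comm x y]⟩

theorem mono {Y : Set E} (hf : IsConvexKatetovOn X f) (hYX : Y ⊆ X) (hY : Convex ℝ Y) :
    IsConvexKatetovOn Y f where
  convexOn := hf.convexOn.subset hYX hY
  le_add_dist x hx y hy := hf.le_add_dist x (hYX hx) y (hYX hy)
  dist_le_add x hx y hy := hf.dist_le_add x (hYX hx) y (hYX hy)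

theorem continuousOn (hf : IsConvexKatetovOn X f) : ContinuousOn f X := by
  refine LipschitzOnWith.continuousOn (K := 1) (LipschitzOnWith.of_dist_le_mul fun x hx y hy => ?_)
  simpa [Real.dist_eq] using hf.abs_sub_le_dist hx hy

theorem sup_of_le_add_dist (hf : IsConvexKatetovOn X f) (hg : ConvexOn ℝ X g)
    (hgd : ∀ x ∈ X, ∀ y ∈ X, g x ≤ g y + dist x y) :
    IsConvexKatetovOn X (fun x => max (f x) (g x)) where
  convexOn := hf.convexOn.sup hg
  le_add_dist x hx y hy := max_le
    ((hf.le_add_dist x hx y hy).trans (by gcongr; exact le_max_left _ _))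
    ((hgd x hx y hy).trans (by gcongr; exact le_max_right _ _))
  dist_le_add x hx y hy := (hf.dist_le_add x hx y hy).trans
    (add_le_add (le_max_left _ _) (le_max_left _ _))

theorem add_const (hf : IsConvexKatetovOn X f) {c : ℝ} (hc : 0 ≤ c) :
    IsConvexKatetovOn X (fun x => f x + c) where
  convexOn := hf.convexOn.add (convexOn_const c hf.convexOn.1)
  le_add_dist x hx y hy := by linarith [hf.le_add_dist x hx y hy]
  dist_le_add x hx y hy := by linarith [hf.dist_le_add x hx y hy]

theorem bddBelow_range (hf : IsConvexKatetovOn X f) (y : E) :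
    BddBelow (Set.range fun x : X => f x + dist (x : E) y) :=
  ⟨0, by rintro _ ⟨x, rfl⟩; exact add_nonneg (hf.nonneg x.2) dist_nonneg⟩

theorem katetovExt_le (hf : IsConvexKatetovOn X f) {x : E} (hx : x ∈ X) (y : E) :
    katetovExt X f y ≤ f x + dist x y :=
  ciInf_le (hf.bddBelow_range y) (⟨x, hx⟩ : X)

theorem katetovExt_eq_of_mem (hf : IsConvexKatetovOn X f) {x : E} (hx : x ∈ X) :
    katetovExt X f x = f x := by
  refine le_antisymm ((hf.katetovExt_le hx x).trans_eq (by simp)) ?_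
  have : Nonempty X := ⟨⟨x, hx⟩⟩
  exact le_ciInf fun y => by linarith [hf.le_add_dist x hx y y.2, dist_comm x y]

theorem exists_lt_of_katetovExt_lt (hX : X.Nonempty) {y : E} {c : ℝ}
    (h : katetovExt X f y < c) : ∃ x ∈ X, f x + dist x y < c := by
  have := hX.to_subtype
  obtain ⟨x, hx⟩ := exists_lt_of_ciInf_lt h
  exact ⟨x, x.2, hx⟩

theorem exists_katetovExt_eq (hf : IsConvexKatetovOn X f) (hX : IsCompact X)
    (hne : X.Nonempty) (y : E) : ∃ x ∈ X, katetovExt X f y = f x + dist x y := by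
  obtain ⟨x, hx, hmin⟩ := hX.exists_isMinOn hne
    (f := fun x => f x + dist x y)
    (hf.continuousOn.add (continuous_id.dist continuous_const).continuousOn)
  have := hne.to_subtype
  exact ⟨x, hx, le_antisymm (hf.katetovExt_le hx y) (le_ciInf fun z => hmin z.2)⟩

protected theorem katetovExt (hf : IsConvexKatetovOn X f) (hX : X.Nonempty) :
    IsConvexKatetovOn Set.univ (katetovExt X f) := by
  refine ⟨⟨convex_univ, ?_⟩, ?_, ?_⟩
  · intro y _ y' _ a b ha hb hab
    refine le_of_forall_pos_le_add fun ε hε => ?_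
    obtain ⟨x, hx, h⟩ := exists_lt_of_katetovExt_lt hX (lt_add_of_pos_right (katetovExt X f y) hε)
    obtain ⟨x', hx', h'⟩ :=
      exists_lt_of_katetovExt_lt hX (lt_add_of_pos_right (katetovExt X f y') hε)
    have h1 := hf.katetovExt_le (hf.convexOn.1 hx hx' ha hb hab) (a • y + b • y')
    have h2 := hf.convexOn.2 hx hx' ha hb hab
    have h3 : dist (a • x + b • x') (a • y + b • y') ≤ a * dist x y + b * dist x' y' := by
      refine (dist_add_add_le _ _ _ _).trans_eq ?_
      rw [dist_smul₀, dist_smul₀, Real.norm_of_nonneg ha, Real.norm_of_nonneg hb]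
    simp only [smul_eq_mul] at h2 ⊢
    have h4 := mul_le_mul_of_nonneg_left h.le ha
    have h5 := mul_le_mul_of_nonneg_left h'.le hb
    have h6 : a * ε + b * ε = ε := by rw [← add_mul, hab, one_mul]
    linarith
  · intro y _ y' _
    refine le_of_forall_pos_le_add fun ε hε => ?_
    obtain ⟨x, hx, h⟩ := exists_lt_of_katetovExt_lt hX (lt_add_of_pos_right (katetovExt X f y') hε)
    linarith [hf.katetovExt_le hx y, dist_triangle x y' y, dist_comm y y']
  · intro y _ y' _
    refine le_of_forall_pos_le_add fun ε hε => ?_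
    obtain ⟨x, hx, h⟩ :=
      exists_lt_of_katetovExt_lt hX (lt_add_of_pos_right (katetovExt X f y) (half_pos hε))
    obtain ⟨x', hx', h'⟩ :=
      exists_lt_of_katetovExt_lt hX (lt_add_of_pos_right (katetovExt X f y') (half_pos hε))
    linarith [hf.dist_le_add x hx x' hx', dist_triangle4 y x x' y', dist_comm x y]

/-- Two convex Katětov functions which satisfy the mixed Katětov inequality have a common lower
bound among the convex Katětov functions. -/
theorem exists_le_le (hf : IsConvexKatetovOn Set.univ f) (hg : IsConvexKatetovOn Set.univ g)
    (h : ∀ x y, dist x y ≤ f x + g y) :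
    ∃ k, IsConvexKatetovOn Set.univ k ∧ (∀ x, k x ≤ f x) ∧ ∀ x, k x ≤ g x := by
  let ξ : OneType E := (oneTypeEquiv E).symm ⟨f, hf⟩
  let ζ : OneType E := (oneTypeEquiv E).symm ⟨g, hg⟩
  have hξ : ∀ x, ξ.1 (-x, 1) = f x := congrFun (OneType.toFun_symm ⟨f, hf⟩)
  have hζ : ∀ x, ζ.1 (-x, 1) = g x := congrFun (OneType.toFun_symm ⟨g, hg⟩)
  -- The infimum of the two seminorms is still a type: splitting `(a, 0)` with `x`-coefficients `β`
  -- and `-β` gives `|β| (f x + g y)`, where `a = β (y - x)`, so the mixed inequality applies.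
  have key : ∀ a, (ξ.1 ⊓ ζ.1) (a, 0) = ‖a‖ := by
    intro a
    rw [Seminorm.inf_apply_eq_left, ξ.2]
    rintro ⟨b, β⟩
    rw [ξ.2, Prod.mk_sub_mk, zero_sub]
    rcases eq_or_ne β 0 with rfl | hβ
    · rw [neg_zero, ξ.2, ζ.2]
      simpa using norm_add_le b (a - b)
    · obtain ⟨x, rfl⟩ := ConvexKatetov.exists_rep hβ b
      obtain ⟨y, hy⟩ := ConvexKatetov.exists_rep (neg_ne_zero.2 hβ) (a - -(β • x))
      have ea : a = β • (y - x) := by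
        rw [eq_add_of_sub_eq hy]; module
      have e1 : ((-(β • x), β) : E × ℝ) = β • (-x, 1) := by ext <;> simp
      have e2 : ((-(-β • y), -β) : E × ℝ) = (-β) • (-y, 1) := by ext <;> simp
      rw [hy, e1, e2, map_smul_eq_mul, map_smul_eq_mul, hξ, hζ, norm_neg, ← mul_add, ea,
        norm_smul, ← dist_eq_norm, dist_comm]
      exact mul_le_mul_of_nonneg_left (h x y) (norm_nonneg β)
  let κ : OneType E := ⟨ξ.1 ⊓ ζ.1, key⟩
  exact ⟨κ.toFun, κ.isConvexKatetovOn_toFun,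
    fun x => (inf_le_left (a := ξ.1) (b := ζ.1) (-x, 1)).trans_eq (hξ x),
    fun x => (inf_le_right (a := ξ.1) (b := ζ.1) (-x, 1)).trans_eq (hζ x)⟩

end IsConvexKatetovOn

/-! ### Isolated types are local and `∂`-maximal -/

namespace ConvexKatetov

variable {E : Type u} [NormedAddCommGroup E] [NormedSpace ℝ E]

theorem isIsolated_symm_iff (f : ConvexKatetov E) :
    ((oneTypeEquiv E).symm f).IsIsolated ↔ ∀ ε > (0 : ℝ), ∃ A : Set E, A.Finite ∧ ∃ δ > 0,
      ∀ g : E → ℝ, IsConvexKatetovOn Set.univ g → (∀ a ∈ A, |g a - f.1 a| < δ) →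
        ∀ a, |f.1 a - g a| ≤ ε := by
  rw [OneType.isIsolated_iff, OneType.toFun_symm]
  refine forall₂_congr fun ε _ => exists_congr fun A => and_congr_right fun _ =>
    exists_congr fun δ => and_congr_right fun _ => ⟨fun h g hg => ?_, fun h ζ => ?_⟩
  · let g' : ConvexKatetov E := ⟨g, hg⟩
    have := h ((oneTypeEquiv E).symm g')
    rwa [OneType.toFun_symm g'] at this
  · exact h _ ζ.isConvexKatetovOn_toFun

theorem convexConj_le_coe_iff {f : E → ℝ} {l : StrongDual ℝ E} {C : ℝ} :
    convexConj f l ≤ C ↔ ∀ v, l v - f v ≤ C := by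
  simp only [convexConj, iSup_le_iff, EReal.coe_le_coe_iff]

theorem isBoundaryMaximal_iff {f : ConvexKatetov E} :
    f.IsBoundaryMaximal ↔ ∀ g : E → ℝ, IsConvexKatetovOn Set.univ g → (∀ v, g v ≤ f.1 v) →
      ∀ l : StrongDual ℝ E, ‖l‖ = 1 → ∀ C : ℝ, (∀ v, l v - f.1 v ≤ C) → ∀ v, l v - g v ≤ C := by
  constructor
  · intro h g hg hgf l hl C hC
    exact convexConj_le_coe_iff.1 ((h ⟨g, hg⟩ hgf l hl).trans (convexConj_le_coe_iff.2 hC))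
  · intro h g hgf l hl
    refine EReal.le_of_forall_lt_iff_le.1 fun C hC => ?_
    exact convexConj_le_coe_iff.2 (h g.1 g.2 hgf l hl C (convexConj_le_coe_iff.1 hC.le))

/-- Since `g ≤ f + e`, the functions `f` and `g + e` satisfy the mixed Katětov inequality.
Maximality applies to their common lower bound. -/
theorem IsBoundaryMaximal.sub_le_of_le_add {f : ConvexKatetov E} (hf : f.IsBoundaryMaximal)
    {g : E → ℝ} (hg : IsConvexKatetovOn Set.univ g) {e : ℝ} (he : 0 ≤ e)
    (hgf : ∀ v, g v ≤ f.1 v + e) {l : StrongDual ℝ E} (hl : ‖l‖ = 1) {C : ℝ}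
    (hC : ∀ v, l v - f.1 v ≤ C) (v : E) : l v - g v ≤ C + e := by
  obtain ⟨k, hk, hkf, hkg⟩ := f.2.exists_le_le (hg.add_const he) fun x y => by
    linarith [hg.dist_le_add x trivial y trivial, hgf x]
  linarith [isBoundaryMaximal_iff.1 hf k hk hkf l hl C hC v, hkg v]

theorem isLocal_of_isIsolated {f : ConvexKatetov E}
    (h : ((oneTypeEquiv E).symm f).IsIsolated) : f.IsLocal := by
  rw [isIsolated_symm_iff] at h
  choose A hA δ hδ H using fun k : ℕ => h (1 / ((k : ℝ) + 1)) Nat.one_div_pos_of_nat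
  -- The point 0 only ensures that the hull is non-empty.
  have hX : ∀ k, IsConvexKatetovOn (convexHull ℝ (insert 0 (A k))) f.1 := fun k =>
    f.2.mono (Set.subset_univ _) (convex_convexHull ℝ _)
  have hne : ∀ k, (convexHull ℝ (insert 0 (A k))).Nonempty := fun k =>
    (Set.insert_nonempty _ _).convexHull
  refine ⟨fun k => convexHull ℝ (insert 0 (A k)), fun _ => f.1, fun k =>
    ⟨((hA k).insert 0).isCompact_convexHull ℝ, hne k, hX k⟩, ?_⟩
  refine Metric.tendstoUniformly_iff.2 fun ε hε => ?_
  filter_upwards [tendsto_one_div_add_atTop_nhds_zero_nat.eventually_lt_const hε] with k hk x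
  refine lt_of_le_of_lt (H k _ ((hX k).katetovExt (hne k)) (fun a ha => ?_) x) hk
  rw [(hX k).katetovExt_eq_of_mem (subset_convexHull ℝ _ (Set.mem_insert_of_mem _ ha)), sub_self,
    abs_zero]
  exact hδ k

/-- Between `g ≤ f` there is a convex Katětov function which is close to `f` on a finite set and
is bounded far from the origin by `g`, up to a function of slope less than one. -/
theorem exists_between_of_finite {f g : E → ℝ} (hf : IsConvexKatetovOn Set.univ f)
    (hg : IsConvexKatetovOn Set.univ g) (hgf : ∀ v, g v ≤ f v) {δ : ℝ} (hδ : 0 < δ) {A : Set E}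
    (hA : A.Finite) :
    ∃ (h : E → ℝ) (K ρ : ℝ), IsConvexKatetovOn Set.univ h ∧ (∀ v, h v ≤ f v) ∧
      (∀ a ∈ A, f a - δ < h a) ∧ 0 ≤ ρ ∧ ρ < 1 ∧ ∀ v, h v ≤ max (g v) (K + ρ * ‖v‖) := by
  induction A, hA using Set.Finite.induction_on with
  | empty => exact ⟨g, 0, 0, hg, hgf, by simp, le_rfl, one_pos, fun v => le_max_left _ _⟩
  | @insert a A _ _ ih =>
    obtain ⟨h, K, ρ, hh, hhf, hhA, hρ0, hρ1, hb⟩ := ih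
    obtain ⟨l, hl, hla⟩ := hf.exists_subgradient a
    have hfa := hf.nonneg (Set.mem_univ a)
    obtain ⟨η, hη0, hη1, hηa⟩ : ∃ η : ℝ, 0 < η ∧ η < 1 ∧ η * f a < δ := by
      refine ⟨δ / (2 * (f a + δ)), by positivity, ?_, ?_⟩
      · rw [div_lt_one (by positivity)]; linarith
      · rw [div_mul_eq_mul_div, div_lt_iff₀ (by positivity)]; nlinarith
    have h1η : 0 < 1 - η := by linarith
    have hlv : ∀ v, l v ≤ ‖v‖ := fun v =>
      (le_abs_self _).trans ((l.le_opNorm v).trans (mul_le_of_le_one_left (norm_nonneg v) hl))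
    -- The affine minorant of `f` at `a`, shrunk by `1 - η`: it stays below `f` because `f ≥ 0`,
    -- loses less than `δ` at `a`, and has slope less than 1.
    let m : E → ℝ := fun x => (1 - η) * (f a + l (x - a))
    have hm : ConvexOn ℝ Set.univ m := by
      refine ⟨convex_univ, fun x _ y _ s t hs ht hst => le_of_eq ?_⟩
      obtain rfl : t = 1 - s := by linarith
      simp only [m, map_sub, map_add, map_smul, smul_eq_mul]
      ring
    have hmd : ∀ x ∈ Set.univ, ∀ y ∈ Set.univ, m x ≤ m y + dist x y := by
      intro x _ y _
      have h1 : l (x - a) = l (y - a) + l (x - y) := by rw [← map_add]; congr 1; abel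
      have h2 := hlv (x - y)
      rw [← dist_eq_norm] at h2
      have h3 : (1 - η) * l (x - y) ≤ dist x y := by
        nlinarith [mul_le_mul_of_nonneg_left h2 h1η.le,
          mul_nonneg hη0.le (dist_nonneg (x := x) (y := y))]
      simp only [m, h1]
      linarith
    refine ⟨fun x => max (h x) (m x), max K ((1 - η) * (f a + ‖a‖)), max ρ (1 - η),
      hh.sup_of_le_add_dist hm hmd, fun v => max_le (hhf v) ?_, ?_, le_max_of_le_left hρ0,
      max_lt hρ1 (by linarith), fun v => max_le ?_ ?_⟩
    · calc m v ≤ (1 - η) * f v := mul_le_mul_of_nonneg_left (hla v) h1η.le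
        _ ≤ f v := mul_le_of_le_one_left (hf.nonneg (Set.mem_univ v)) (by linarith)
    · rintro b (rfl | hb)
      · refine lt_max_of_lt_right ?_
        simp only [m, sub_self, map_zero]
        linarith
      · exact lt_max_of_lt_left (hhA b hb)
    · refine (hb v).trans (max_le_max_left _ ?_)
      gcongr
      · exact le_max_left _ _
      · exact le_max_left _ _
    · refine le_max_of_le_right ?_
      calc m v ≤ (1 - η) * (f a + (‖v‖ + ‖a‖)) := by
            refine mul_le_mul_of_nonneg_left ?_ h1η.le
            linarith [hlv (v - a), norm_sub_le v a]
        _ = (1 - η) * (f a + ‖a‖) + (1 - η) * ‖v‖ := by ring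
        _ ≤ _ := by
            gcongr
            · exact le_max_right _ _
            · exact le_max_right _ _

theorem exists_norm_lt_one_of_lt_norm {l : StrongDual ℝ E} {r : ℝ} (hr : r < ‖l‖) :
    ∃ x, ‖x‖ < 1 ∧ r < l x := by
  obtain ⟨x, hx, hrx⟩ := l.exists_lt_apply_of_lt_opNorm hr
  rcases le_total 0 (l x) with h | h
  · exact ⟨x, hx, by rwa [Real.norm_of_nonneg h] at hrx⟩
  · exact ⟨-x, by rwa [norm_neg], by rwa [map_neg, ← Real.norm_of_nonpos h]⟩

theorem isBoundaryMaximal_of_isIsolated {f : ConvexKatetov E}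
    (h : ((oneTypeEquiv E).symm f).IsIsolated) : f.IsBoundaryMaximal := by
  rw [isIsolated_symm_iff] at h
  refine isBoundaryMaximal_iff.2 fun g hg hgf l hl C hC v => le_of_forall_pos_le_add fun ε hε => ?_
  obtain ⟨A, hA, δ, hδ, H⟩ := h ε hε
  obtain ⟨k, K, ρ, hk, hkf, hkA, hρ0, hρ1, hb⟩ := exists_between_of_finite f.2 hg hgf hδ hA
  have hfk : ∀ w, f.1 w ≤ k w + ε := fun w => by
    have := H k hk (fun a ha => by
      rw [abs_sub_lt_iff]; constructor <;> linarith [hkf a, hkA a ha]) w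
    linarith [(abs_le.1 this).2]
  by_contra! hlt
  -- So far out that the bound of slope `ρ < 1` lies below `g v + t`.
  obtain ⟨t, ht0, ht⟩ : ∃ t : ℝ, 0 < t ∧ K + ρ * (‖v‖ + t) ≤ g v + t := by
    refine ⟨max 1 ((K + ρ * ‖v‖ - g v) / (1 - ρ)), lt_max_of_lt_left one_pos, ?_⟩
    have := (div_le_iff₀ (by linarith : 0 < 1 - ρ)).1
      (le_max_right 1 ((K + ρ * ‖v‖ - g v) / (1 - ρ)))
    linarith
  -- Chosen after `t`, so that the loss `t (1 - l x)` is less than the assumed excess of `l v - g v`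
  -- over `C + ε`.
  obtain ⟨x, hx, hlx⟩ := exists_norm_lt_one_of_lt_norm (l := l)
    (r := 1 - (l v - g v - (C + ε)) / t) (by
      rw [hl]; exact sub_lt_self _ (div_pos (by linarith) ht0))
  have htx : ‖t • x‖ ≤ t := by
    rw [norm_smul, Real.norm_of_nonneg ht0.le]
    exact mul_le_of_le_one_right ht0.le hx.le
  have h1 : k (v + t • x) ≤ g v + t := by
    refine (hb _).trans (max_le ?_ ?_)
    · have := hg.le_add_dist (v + t • x) trivial v trivial
      rw [dist_eq_norm, add_sub_cancel_left] at this
      linarith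
    · have : ρ * ‖v + t • x‖ ≤ ρ * (‖v‖ + t) :=
        mul_le_mul_of_nonneg_left ((norm_add_le _ _).trans (by linarith)) hρ0
      linarith
  have h2 := hC (v + t • x)
  rw [map_add, map_smul, smul_eq_mul] at h2
  have h3 : t - (l v - g v - (C + ε)) < t * l x := by
    have := mul_lt_mul_of_pos_left hlx ht0
    rwa [mul_sub, mul_one, mul_div_cancel₀ _ ht0.ne'] at this
  linarith [hfk (v + t • x)]

/-! ### Local `∂`-maximal functions are isolated -/

/-- Away from `X`, the canonical extension of a function on a compact set `X` has at each point a
subgradient of norm one. -/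
theorem exists_subgradient_norm_eq_one {X : Set E} {φ : E → ℝ} (hφ : IsConvexKatetovOn X φ)
    (hX : IsCompact X) (hne : X.Nonempty) {y : E} (hy : y ∉ X) :
    ∃ l : StrongDual ℝ E, ‖l‖ = 1 ∧ ∀ z, katetovExt X φ y + l (z - y) ≤ katetovExt X φ z := by
  obtain ⟨x, hx, hxy⟩ := hφ.exists_katetovExt_eq hX hne y
  obtain ⟨l, hl, hly⟩ := (hφ.katetovExt hne).exists_subgradient y
  refine ⟨l, le_antisymm hl ?_, hly⟩
  -- From `y` to the minimiser `x` the extension drops by the full distance, which forces the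
  -- subgradient to have norm at least one.
  have h1 := hly x
  rw [hφ.katetovExt_eq_of_mem hx, hxy, dist_eq_norm] at h1
  have h2 : ‖x - y‖ ≤ ‖l‖ * ‖x - y‖ := by
    refine le_trans ?_ (l.le_opNorm (x - y))
    exact le_trans (by linarith) (neg_le_abs (l (x - y)))
  have h3 : 0 < ‖x - y‖ := norm_pos_iff.2 (sub_ne_zero.2 fun h => hy (h ▸ hx))
  exact le_of_mul_le_mul_right (by rwa [one_mul]) h3

theorem isIsolated_of_isLocal {f : ConvexKatetov E} (hloc : f.IsLocal)
    (hmax : f.IsBoundaryMaximal) : ((oneTypeEquiv E).symm f).IsIsolated := by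
  refine (isIsolated_symm_iff f).2 fun ε hε => ?_
  obtain ⟨X, φ, hX, hlim⟩ := hloc
  obtain ⟨n, hn⟩ := (Metric.tendstoUniformly_iff.1 hlim (ε / 5) (by positivity)).exists
  obtain ⟨hXc, hXne, hφ⟩ := hX n
  have hψ := hφ.katetovExt hXne
  have hfψ : ∀ z, f.1 z ≤ katetovExt (X n) (φ n) z + ε / 5 := fun z => by
    have := hn z
    rw [Real.dist_eq, abs_lt] at this
    linarith
  have hψf : ∀ z, katetovExt (X n) (φ n) z ≤ f.1 z + ε / 5 := fun z => by
    have := hn z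
    rw [Real.dist_eq, abs_lt] at this
    linarith
  -- Three errors of `ε / 15` (two Lipschitz, one on the net) give `ε / 5` on `X n`.
  obtain ⟨A, hA, hcover⟩ := Metric.totallyBounded_iff.1 hXc.totallyBounded (ε / 15) (by positivity)
  refine ⟨A, hA, ε / 15, by positivity, fun g hg hgA => ?_⟩
  have hgX : ∀ x ∈ X n, |f.1 x - g x| ≤ ε / 5 := by
    intro x hx
    obtain ⟨a, ha, hxa⟩ := Set.mem_iUnion₂.1 (hcover hx)
    rw [Metric.mem_ball] at hxa
    have h1 := abs_le.1 (f.2.abs_sub_le_dist (Set.mem_univ x) (Set.mem_univ a))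
    have h2 := abs_le.1 (hg.abs_sub_le_dist (Set.mem_univ x) (Set.mem_univ a))
    have h3 := abs_lt.1 (hgA a ha)
    exact abs_le.2 ⟨by linarith, by linarith⟩
  have hgf : ∀ y, g y ≤ f.1 y + 3 * (ε / 5) := by
    intro y
    obtain ⟨x, hx, hxy⟩ := hφ.exists_katetovExt_eq hXc hXne y
    have h1 := hfψ x
    rw [hφ.katetovExt_eq_of_mem hx] at h1
    linarith [hg.le_add_dist y trivial x trivial, hψf y, (abs_le.1 (hgX x hx)).1, dist_comm x y]
  intro y
  by_cases hy : y ∈ X n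
  · exact (hgX y hy).trans (by linarith)
  · obtain ⟨l, hl, hly⟩ := exists_subgradient_norm_eq_one hφ hXc hXne hy
    -- The subgradient inequality bounds `l - f` by `C`. The total loss is `ε / 5` in `C`, `3ε / 5`
    -- from `hgf`, and `ε / 5` in returning from the extension to `f` at `y`.
    have h1 := hmax.sub_le_of_le_add hg (by positivity) hgf hl
      (C := l y - katetovExt (X n) (φ n) y + ε / 5) (fun z => by
        have := hly z
        rw [map_sub] at this
        linarith [hψf z]) y
    exact abs_le.2 ⟨by linarith [hgf y], by linarith [hfψ y]⟩

end ConvexKatetov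

theorem mainTheorem7 {E : Type*} [NormedAddCommGroup E] [NormedSpace ℝ E]
    (f : ConvexKatetov E) :
    ((oneTypeEquiv E).symm f).IsIsolated ↔ f.IsLocal ∧ f.IsBoundaryMaximal :=
  ⟨fun h => ⟨ConvexKatetov.isLocal_of_isIsolated h,
    ConvexKatetov.isBoundaryMaximal_of_isIsolated h⟩,
    fun h => ConvexKatetov.isIsolated_of_isLocal h.1 h.2⟩
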